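/- Let $p>3$ be a prime. For rational numbers $a,b$, write $a\equiv b\pmod p$ if the denominators of $a$ and $b$ (in lowest terms) are not divisible by $p$ and $p$ divides the numerator of $a-b$ in lowest terms. Let $H_n=\sum_{0<k\le n}\frac1k$ be the $n$-th harmonic number, let $B_n(x)$ be the Bernoulli polynomial of degree $n$, given by $\frac{te^{xt}}{e^t-1}=\sum_{n\ge 0}B_n(x)\frac{t^n}{n!}$, and let $\left(\frac{p}{3}\right)$ be the Legendre symbol, which is $1$ if $p\equiv 1\pmod 3$ and $-1$ if $p\equiv 2\pmod 3$. Then $$\sum_{k=1}^{p-1}\frac{\binom{2k}{k}}{k}H_k\equiv\frac13\left(\frac p3\right)B_{p-2}\left(\frac13\right)\pmod p$$ and $$\sum_{k=1}^{p-1}\frac{\binom{2k}{k}}{k}H_{2k}\equiv\frac7{12}\left(\frac p3\right)B_{p-2}\left(\frac13\right)\pmod p.$$ -/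

import Mathlib

/-- Congruence of rational numbers modulo a positive integer `m`, in the usual number-theoretic
sense: both sides have denominators (in lowest terms) coprime to `m`, i.e. both sides are
`m`-integral, and `m` divides the numerator of their difference in lowest terms. -/
def RatModEq (m : ℕ) (a b : ℚ) : Prop :=
  a.den.Coprime m ∧ b.den.Coprime m ∧ (m : ℤ) ∣ (a - b).num

/-! Write `t k` for the summand with `k` replaced by `k + 1`. The transform `∑ k ≤ J, (-1)^(J-k) *
C(J+k+1, J-k) * t k` has an exact value over `ℚ`: `2/(J+1)^2` when the harmonic factor is `H_k`, and
`(-1)^J/(J+1)^2` when it is `H_{2k} - H_k`. Both come from summation by parts and the vanishing of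
high finite differences of polynomials.

Modulo `p` the transform can be undone for the total sum. In `∑ i, C(2N, i) x^(i-N) = (x + 2 +
1/x)^N` the right side is `1` at a primitive cube root of unity and `0` at `-1` (for `N > 0`), so a
combination of the two expresses `1` through `C(2N, i)` with `i < N`. With `N = p - (k+1)` these
binomials are congruent to `(-1)^i * C(2k+1+i, i)`, exactly the transform coefficients. Hence `∑ t
k` becomes a sum of periodic weights over `j^2`, `0 < j < p` (`sum_eq_sum_mul_of_alternating_sum`).

Reflection `j ↦ p - j` and doubling `j ↦ 2j` reduce every such sum to `T = sumDivSq p cubicTrace`: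
the `H_k` sum is `2T` and the `H_{2k} - H_k` sum is `3T/2`, so the `H_{2k}` sum is `7T/2`. Finally
`3T` is the sum of `1/i^2 = i^(p-3)` over `i ≤ p/3`, which Faulhaber's formula evaluates, giving `6T
= (p/3) B_{p-2}(1/3)`. -/

/-! ### Exact binomial and harmonic identities over `ℚ`. -/

-- This is an `n`-th finite difference of `C(y+k, m)`, a polynomial of degree `m` in `k`; Pascal's
-- rule lowers `n` and `m` together.
open Finset in
theorem sum_range_alternating_choose_mul_choose_add (n m y : ℕ) (hmn : m ≤ n) :
    ∑ k ∈ range (n + 1), (-1 : ℚ) ^ k * n.choose k * (y + k).choose m =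
      if m = n then (-1) ^ n else 0 := by
  induction n generalizing m y with
  | zero => obtain rfl : m = 0 := by omega
            simp
  | succ n ih =>
    have pascal : ∀ z : ℕ, ∑ k ∈ range (n + 2), (-1 : ℚ) ^ k * (n + 1).choose k * (z + k).choose m =
        ∑ k ∈ range (n + 1), (-1 : ℚ) ^ k * n.choose k *
          ((z + k).choose m - (z + k + 1).choose m) := by
      intro z
      rw [sum_range_succ']
      have h1 : ∑ k ∈ range (n + 1), (-1 : ℚ) ^ k * n.choose k * (z + k).choose m =
          ∑ k ∈ range (n + 1), (-1 : ℚ) ^ (k + 1) * n.choose (k + 1) * (z + (k + 1)).choose m +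
            z.choose m := by
        have := sum_range_succ' (fun k => (-1 : ℚ) ^ k * n.choose k * (z + k).choose m) (n + 1)
        rw [sum_range_succ] at this
        simpa using this
      simp only [mul_sub, sum_sub_distrib, h1]
      simp only [Nat.choose_succ_succ n, pow_succ, Nat.cast_add, pow_zero, Nat.choose_zero_right,
        add_zero, Nat.cast_one, one_mul]
      rw [add_sub_right_comm, ← sum_sub_distrib]
      congr 1
      refine sum_congr rfl fun k _ => ?_
      rw [← add_assoc]
      ring
    rw [pascal]
    cases m with
    | zero => simp
    | succ m =>
      have h2 : ∀ k : ℕ, (((y + k).choose (m + 1) : ℚ) - (y + k + 1).choose (m + 1)) =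
          -((y + k).choose m : ℚ) := by
        intro k
        rw [Nat.choose_succ_succ (y + k) m]
        push_cast
        ring
      simp only [h2, mul_neg, sum_neg_distrib, ih m y (by omega), add_left_inj]
      split_ifs <;> simp [pow_succ]

theorem Nat.cast_choose_succ_mul (n k : ℕ) :
    (n.choose (k + 1) : ℚ) * (k + 1) = n.choose k * (n - k) := by
  rcases le_or_gt k n with h | h
  · have := Nat.choose_succ_right_eq n k
    rw [← Nat.cast_sub h]
    exact_mod_cast this
  · simp [Nat.choose_eq_zero_of_lt h, Nat.choose_eq_zero_of_lt (h.trans k.lt_succ_self)]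

theorem Nat.cast_succ_choose_mul (n k : ℕ) :
    ((n + 1).choose k : ℚ) * (n + 1 - k) = n.choose k * (n + 1) := by
  have h1 := Nat.cast_choose_succ_mul (n + 1) k
  have h2 : ((n + 1 : ℕ) : ℚ) * n.choose k = (n + 1).choose (k + 1) * (k + 1 : ℕ) := by
    exact_mod_cast Nat.add_one_mul_choose_eq n k
  push_cast at h1 h2
  linarith

open Finset in
theorem sum_range_alternating_choose_mul_choose (J m : ℕ) :
    ∑ k ∈ range (m + 1), (-1 : ℚ) ^ k * (J + 1).choose k * (J + k).choose k =
      (-1) ^ m * J.choose m * (J + 1 + m).choose m := by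
  induction m with
  | zero => simp
  | succ m ih =>
    rw [sum_range_succ, ih]
    have e1 := Nat.cast_choose_succ_mul J m
    have e2 := Nat.cast_choose_succ_mul (J + 1) m
    have e2' : ((J + 1).choose (m + 1) : ℚ) = J.choose m + J.choose (m + 1) := by
      exact_mod_cast Nat.choose_succ_succ J m
    have e3 : ((J + (m + 1)).choose (m + 1) : ℚ) * (m + 1) = (J + 1 + m).choose m * (J + 1) := by
      have := Nat.cast_choose_succ_mul (J + (m + 1)) m
      rw [this, show J + (m + 1) = J + 1 + m by ring]
      push_cast
      ring
    have e4 : ((J + 1 + (m + 1)).choose (m + 1) : ℚ) * (m + 1) =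
        (J + 1 + m).choose m * (J + m + 2) := by
      have : ((J + 1 + m + 1 : ℕ) : ℚ) * (J + 1 + m).choose m =
          (J + 1 + m + 1).choose (m + 1) * (m + 1 : ℕ) := by
        exact_mod_cast Nat.add_one_mul_choose_eq (J + 1 + m) m
      rw [← add_assoc]
      push_cast at this
      linarith
    have hm : (m + 1 : ℚ) ≠ 0 := by positivity
    apply mul_right_cancel₀ hm
    rw [e2']
    generalize ((J.choose m : ℕ) : ℚ) = a at *
    generalize ((J.choose (m + 1) : ℕ) : ℚ) = b at *
    generalize (((J + 1 + m).choose m : ℕ) : ℚ) = c at *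
    generalize (((J + (m + 1)).choose (m + 1) : ℕ) : ℚ) = d at *
    generalize (((J + 1 + (m + 1)).choose (m + 1) : ℕ) : ℚ) = e at *
    rw [pow_succ]
    linear_combination (-1 : ℚ) ^ m * (-(a + b) * e3 + b * e4 + c * e1)

open Finset in
theorem sum_range_mul_eq_sub_sum_range_partialSum_mul (W h P : ℕ → ℚ)
    (hP : ∀ m, ∑ k ∈ range (m + 1), W k = P m) (h0 : h 0 = 0) (n : ℕ) :
    ∑ k ∈ range (n + 1), W k * h k = P n * h n - ∑ m ∈ range n, P m * (h (m + 1) - h m) := by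
  induction n with
  | zero => simp [h0]
  | succ n ih =>
    rw [sum_range_succ, ih, sum_range_succ, ← hP (n + 1), sum_range_succ _ (n + 1), hP]
    ring

-- Abel summation: the partial sums of the weights have a closed form with the factor `C(J, m)`, so
-- the boundary term at `m = J + 1` vanishes and only the increments of `h` remain.
open Finset in
theorem sum_range_alternating_choose_mul_choose_mul (h : ℕ → ℚ) (h0 : h 0 = 0) (J : ℕ) :
    ∑ k ∈ range (J + 2), (-1 : ℚ) ^ k * (J + 1).choose k * (J + k).choose k * h k =
      -∑ m ∈ range (J + 1),
        (-1 : ℚ) ^ m * J.choose m * (J + 1 + m).choose m * (h (m + 1) - h m) := by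
  rw [sum_range_mul_eq_sub_sum_range_partialSum_mul _ h _
    (sum_range_alternating_choose_mul_choose J) h0]
  simp

theorem harmonic_add_one_sub (m : ℕ) : harmonic (m + 1) - harmonic m = 1 / (m + 1) := by
  rw [harmonic_succ]
  push_cast
  rw [one_div]
  ring

theorem cast_choose_add_div (J m : ℕ) :
    ((J + 1 + m).choose m : ℚ) / (m + 1) = (J + 1 + m).choose J / (J + 1) := by
  have h := Nat.cast_choose_succ_mul (J + 1 + m) m
  have hs : (J + 1 + m).choose (m + 1) = (J + 1 + m).choose J :=
    Nat.choose_symm_of_eq_add (by ring)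
  rw [hs] at h
  push_cast at h
  have h1 : (m + 1 : ℚ) ≠ 0 := by positivity
  have h2 : (J + 1 : ℚ) ≠ 0 := by positivity
  rw [div_eq_div_iff h1 h2]
  linarith

open Finset in
theorem sum_range_alternating_div_succ (J : ℕ) :
    ∑ m ∈ range (J + 1), (-1 : ℚ) ^ m * J.choose m * (J + 1 + m).choose m * (1 / (m + 1)) =
      (-1) ^ J / (J + 1) := by
  have h := sum_range_alternating_choose_mul_choose_add J J (J + 1) le_rfl
  rw [if_pos rfl] at h
  rw [← h, sum_div]
  refine sum_congr rfl fun m _ => ?_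
  have := cast_choose_add_div J m
  rw [mul_one_div, mul_div_assoc, this, mul_div_assoc]

open Finset in
theorem sum_range_alternating_mul_harmonic (J : ℕ) :
    ∑ k ∈ range (J + 2), (-1 : ℚ) ^ k * (J + 1).choose k * (J + k).choose k * harmonic k =
      (-1) ^ (J + 1) / (J + 1) := by
  rw [sum_range_alternating_choose_mul_choose_mul _ harmonic_zero]
  simp only [harmonic_add_one_sub, sum_range_alternating_div_succ, pow_succ]
  ring

-- The value does not depend on `J`: when consecutive sums are subtracted, the factor `2m+1` cancels
-- termwise, leaving `1/(J+1)` times a `(J+1)`-st difference of a polynomial of degree `J`.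
open Finset in
theorem sum_range_alternating_div_odd (J : ℕ) :
    ∑ m ∈ range (J + 1), (-1 : ℚ) ^ m * J.choose m * (J + 1 + m).choose (m + 1) / (2 * m + 1) =
      1 := by
  induction J with
  | zero => simp
  | succ J ih =>
    have h0 := sum_range_alternating_choose_mul_choose_add (J + 1) J (J + 1) (by omega)
    rw [if_neg (by omega)] at h0
    have h1 : ∑ m ∈ range (J + 2),
        (-1 : ℚ) ^ m * J.choose m * (J + 1 + m).choose (m + 1) / (2 * m + 1) = 1 := by
      rw [sum_range_succ, ih]
      simp
    refine Eq.trans ?_ h1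
    rw [← sub_eq_zero, ← sum_sub_distrib, ← mul_zero (1 / (J + 1 : ℚ)), ← h0, mul_sum]
    refine sum_congr rfl fun m _ => ?_
    have hs : (J + 1 + m).choose (m + 1) = (J + 1 + m).choose J :=
      Nat.choose_symm_of_eq_add (by ring)
    have e1 := Nat.cast_succ_choose_mul J m
    have e2 := Nat.cast_succ_choose_mul (J + 1 + m) (m + 1)
    rw [hs, show J + 1 + m + 1 = J + 1 + 1 + m by ring] at e2
    rw [hs]
    push_cast at e2
    have n1 : (2 * m + 1 : ℚ) ≠ 0 := by positivity
    have n2 : (J + 1 : ℚ) ≠ 0 := by positivity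
    field_simp
    generalize ((J.choose m : ℕ) : ℚ) = a at *
    generalize (((J + 1).choose m : ℕ) : ℚ) = b at *
    generalize (((J + 1 + m).choose J : ℕ) : ℚ) = c at *
    generalize (((J + 1 + 1 + m).choose (m + 1) : ℕ) : ℚ) = d at *
    linear_combination b * e2 + c * e1

open Finset in
theorem sum_range_alternating_mul_harmonic_sub (J : ℕ) :
    ∑ k ∈ range (J + 2), (-1 : ℚ) ^ k * (J + 1).choose k * (J + k).choose k *
      (harmonic (2 * k) - harmonic k) = -1 / (2 * (J + 1)) := by
  rw [sum_range_alternating_choose_mul_choose_mul (fun k => harmonic (2 * k) - harmonic k)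
    (by simp)]
  have hd : ∀ m : ℕ, (harmonic (2 * (m + 1)) - harmonic (m + 1) - (harmonic (2 * m) - harmonic m)) =
      1 / (2 * m + 1) - 1 / 2 * (1 / (m + 1)) := by
    intro m
    have h1 := harmonic_add_one_sub m
    have h2 := harmonic_add_one_sub (2 * m)
    have h3 := harmonic_add_one_sub (2 * m + 1)
    rw [show 2 * (m + 1) = 2 * m + 1 + 1 by ring]
    push_cast at h2 h3
    have : (1 : ℚ) / (2 * m + 1 + 1) = 1 / 2 * (1 / (m + 1)) := by field_simp; ring
    linarith
  have hJ : (J + 1 : ℚ) ≠ 0 := by positivity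
  have hsum : ∑ m ∈ range (J + 1), (-1 : ℚ) ^ m * J.choose m * (J + 1 + m).choose m *
      (1 / (2 * m + 1) - 1 / 2 * (1 / (m + 1))) = 1 / (2 * (J + 1)) *
        ∑ m ∈ range (J + 1), (-1 : ℚ) ^ m * J.choose m * (J + 1 + m).choose (m + 1) / (2 * m + 1) := by
    rw [mul_sum]
    refine sum_congr rfl fun m _ => ?_
    have h := cast_choose_add_div J m
    have hs : (J + 1 + m).choose (m + 1) = (J + 1 + m).choose J :=
      Nat.choose_symm_of_eq_add (by ring)
    have n1 : (2 * m + 1 : ℚ) ≠ 0 := by positivity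
    have n2 : (m + 1 : ℚ) ≠ 0 := by positivity
    rw [div_eq_div_iff n2 hJ] at h
    rw [hs]
    field_simp
    linear_combination J.choose m * h
  simp only [hd, hsum, sum_range_alternating_div_odd]
  ring

theorem centralBinom_mul_choose_eq (k i : ℕ) :
    ((2 * (k + 1)).choose (k + 1) : ℚ) / (k + 1) * (2 * k + 1 + i).choose i =
      2 / (k + i + 1) * ((k + i + 1).choose (k + 1) * (2 * k + 1 + i).choose (k + 1)) := by
  rw [show 2 * (k + 1) = (k + 1) + (k + 1) by ring, show 2 * k + 1 + i = i + (2 * k + 1) by ring,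
    Nat.cast_add_choose, Nat.cast_add_choose, show k + i + 1 = (k + 1) + i by ring,
    Nat.cast_add_choose, show i + (2 * k + 1) = (k + 1) + (k + i) by ring, Nat.cast_add_choose,
    show k + 1 + (k + 1) = 2 * k + 1 + 1 by ring, Nat.factorial_succ (2 * k + 1),
    show k + 1 + i = k + i + 1 by ring, Nat.factorial_succ (k + i)]
  push_cast
  field_simp
  ring

-- A rearrangement of factorials, with `i = J - k`, turns the central binomial weights into the
-- weights `C(J+1, k) * C(J+k, k)` to which Abel summation applies.
open Finset in
theorem sum_range_alternating_centralBinom_mul (h : ℕ → ℚ) (h0 : h 0 = 0) (J : ℕ) :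
    ∑ k ∈ range (J + 1), (-1 : ℚ) ^ (J - k) * (J + k + 1).choose (J - k) *
        (((2 * (k + 1)).choose (k + 1) : ℚ) / (k + 1 : ℕ) * h (k + 1)) =
      2 * (-1) ^ (J + 1) / (J + 1) *
        ∑ k ∈ range (J + 2), (-1 : ℚ) ^ k * (J + 1).choose k * (J + k).choose k * h k := by
  rw [sum_range_succ' _ (J + 1), h0, mul_zero, add_zero, mul_sum]
  refine sum_congr rfl fun k hk => ?_
  obtain ⟨i, rfl⟩ : ∃ i, J = k + i := ⟨J - k, by simp at hk; omega⟩
  have e := centralBinom_mul_choose_eq k i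
  have sgn : (-1 : ℚ) ^ (k + i + 1) * (-1) ^ (k + 1) = (-1) ^ i := by
    rw [← pow_add, show k + i + 1 + (k + 1) = i + 2 * (k + 1) by ring, pow_add, pow_mul]
    simp
  rw [show k + i - k = i by omega, show k + i + k + 1 = 2 * k + 1 + i by ring,
    show k + i + (k + 1) = 2 * k + 1 + i by ring, ← sgn]
  push_cast
  linear_combination (-1 : ℚ) ^ (k + i + 1) * (-1) ^ (k + 1) * h (k + 1) * e

open Finset in
theorem sum_range_alternating_centralBinom_mul_harmonic (J : ℕ) :
    ∑ k ∈ range (J + 1), (-1 : ℚ) ^ (J - k) * (J + k + 1).choose (J - k) *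
        (((2 * (k + 1)).choose (k + 1) : ℚ) / (k + 1 : ℕ) * harmonic (k + 1)) =
      2 / (J + 1) ^ 2 := by
  rw [sum_range_alternating_centralBinom_mul _ harmonic_zero, sum_range_alternating_mul_harmonic]
  have : (-1 : ℚ) ^ (J + 1) * (-1) ^ (J + 1) = 1 := by rw [← mul_pow]; simp
  have hJ : (J + 1 : ℚ) ≠ 0 := by positivity
  field_simp
  linear_combination this

open Finset in
theorem sum_range_alternating_centralBinom_mul_harmonic_sub (J : ℕ) :
    ∑ k ∈ range (J + 1), (-1 : ℚ) ^ (J - k) * (J + k + 1).choose (J - k) *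
        (((2 * (k + 1)).choose (k + 1) : ℚ) / (k + 1 : ℕ) *
          (harmonic (2 * (k + 1)) - harmonic (k + 1))) =
      (-1) ^ J / (J + 1) ^ 2 := by
  rw [sum_range_alternating_centralBinom_mul (fun k => harmonic (2 * k) - harmonic k) (by simp),
    sum_range_alternating_mul_harmonic_sub, pow_succ]
  have hJ : (J + 1 : ℚ) ≠ 0 := by positivity
  field_simp

/-! ### Cube roots of unity and inversion of the transform modulo `p`. -/

/-- The trace `ω ^ x + ω ^ (-x)` of the powers of a primitive cube root of unity `ω`. -/
def cubicTrace (x : ℤ) : ℤ := if 3 ∣ x then 2 else -1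

/-- The sign `(-1) ^ x` of an integer. -/
def paritySign (x : ℤ) : ℤ := if Even x then 1 else -1

theorem cubicTrace_neg (x : ℤ) : cubicTrace (-x) = cubicTrace x := by
  simp [cubicTrace]

theorem cubicTrace_eq_of_dvd_sub {x y : ℤ} (h : 3 ∣ x - y) : cubicTrace x = cubicTrace y := by
  unfold cubicTrace
  congr 1
  simp only [eq_iff_iff]
  omega

theorem cubicTrace_add_add (x y : ℤ) (hy : ¬ 3 ∣ y) :
    cubicTrace x + cubicTrace (x + y) + cubicTrace (x - y) = 0 := by
  unfold cubicTrace
  rcases (by omega : x % 3 = 0 ∨ x % 3 = 1 ∨ x % 3 = 2) with hx | hx | hx <;>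
    rcases (by omega : y % 3 = 1 ∨ y % 3 = 2) with hy | hy <;>
    split_ifs <;> omega

theorem paritySign_neg (x : ℤ) : paritySign (-x) = paritySign x := by
  simp [paritySign]

theorem paritySign_mul_self (x : ℤ) : paritySign x * paritySign x = 1 := by
  unfold paritySign
  split_ifs <;> rfl

theorem paritySign_natCast (n : ℕ) : paritySign n = (-1) ^ n := by
  rcases Nat.even_or_odd n with h | h
  · simp [paritySign, h, h.neg_one_pow]
  · simp [paritySign, h, h.neg_one_pow, Nat.not_even_iff_odd]

theorem paritySign_add (x y : ℤ) : paritySign (x + y) = paritySign x * paritySign y := by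
  unfold paritySign
  by_cases hx : Even x <;> by_cases hy : Even y <;> simp [Int.even_add, hx, hy]

-- For a primitive cube root of unity `ω`, `ω + 2 + ω⁻¹ = 1`, so its `N`-th power is `1` and has
-- trace `2`. In the induction, two Pascal steps multiply by `x + 2 + x⁻¹`, and three consecutive
-- traces sum to `0`.
open Finset in
theorem sum_range_choose_mul_cubicTrace (N : ℕ) :
    ∑ i ∈ range (2 * N + 1), ((2 * N).choose i : ℤ) * cubicTrace (i - N) = 2 := by
  have pascal : ∀ (M : ℕ) (f : ℕ → ℤ), ∑ i ∈ range (M + 2), ((M + 1).choose i : ℤ) * f i =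
      ∑ i ∈ range (M + 1), (M.choose i : ℤ) * (f i + f (i + 1)) := by
    intro M f
    rw [sum_range_succ']
    have := sum_range_succ' (fun i => (M.choose i : ℤ) * f i) (M + 1)
    rw [sum_range_succ, Nat.choose_succ_self] at this
    simp only [mul_add, sum_add_distrib, Nat.choose_succ_succ M, Nat.cast_add, add_mul] at *
    simp only [Nat.cast_zero, zero_mul, add_zero, Nat.choose_zero_right] at *
    rw [this]
    ring
  induction N with
  | zero => simp [cubicTrace]
  | succ N ih =>
    rw [← ih, show 2 * (N + 1) = 2 * N + 1 + 1 by ring, pascal, pascal]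
    refine sum_congr rfl fun i _ => ?_
    congr 1
    have h := cubicTrace_add_add ((i : ℤ) - N) 1 (by norm_num)
    have h1 : ((i + 1 : ℕ) : ℤ) - (N + 1 : ℕ) = i - N := by push_cast; ring
    have h2 : ((i + 1 + 1 : ℕ) : ℤ) - (N + 1 : ℕ) = i - N + 1 := by push_cast; ring
    have h3 : (i : ℤ) - (N + 1 : ℕ) = i - N - 1 := by push_cast; ring
    rw [h1, h2, h3]
    linarith

-- The `paritySign` part is the value at `-1`, namely `0`. Its multiple `2` is chosen to cancel the
-- middle term `i = N`; the symmetry `i ↦ 2N - i` then halves the total `2`.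
open Finset in
theorem sum_range_choose_mul_cubicTrace_sub (N : ℕ) (hN : 0 < N) :
    ∑ i ∈ range N, ((2 * N).choose i : ℤ) * (cubicTrace (N - i) - 2 * paritySign (N - i)) = 1 := by
  have hp : ∑ i ∈ range (2 * N + 1), ((2 * N).choose i : ℤ) * paritySign (i - N) = 0 := by
    have h := Int.alternating_sum_range_choose_of_ne (n := 2 * N) (by omega)
    rw [← mul_zero (paritySign N), ← h, mul_sum]
    refine sum_congr rfl fun i _ => ?_
    rw [sub_eq_add_neg, paritySign_add, paritySign_neg, paritySign_natCast]
    ring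
  have hs : ∑ i ∈ range (2 * N + 1), ((2 * N).choose i : ℤ) *
      (cubicTrace (N - i) - 2 * paritySign (N - i)) = 2 := by
    have h := sum_range_choose_mul_cubicTrace N
    refine Eq.trans ?_ ((congrArg₂ (fun a b => a - 2 * b) h hp).trans (by ring))
    rw [mul_sum, ← sum_sub_distrib]
    refine sum_congr rfl fun i _ => ?_
    rw [← cubicTrace_neg, ← paritySign_neg, neg_sub]
    ring
  have hr : ∑ i ∈ range N, ((2 * N).choose (N + 1 + i) : ℤ) *
      (cubicTrace (N - (N + 1 + i : ℕ)) - 2 * paritySign (N - (N + 1 + i : ℕ))) =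
      ∑ i ∈ range N, ((2 * N).choose i : ℤ) *
        (cubicTrace (N - i) - 2 * paritySign (N - i)) := by
    rw [← sum_range_reflect]
    refine sum_congr rfl fun i hi => ?_
    rw [mem_range] at hi
    have h1 : N + 1 + (N - 1 - i) = 2 * N - i := by omega
    have h2 : ((2 * N - i : ℕ) : ℤ) = 2 * N - i := by push_cast [show i ≤ 2 * N by omega]; ring
    rw [h1, Nat.choose_symm (by omega), h2, ← cubicTrace_neg, ← paritySign_neg,
      show -((N : ℤ) - (2 * N - i)) = N - i by ring]
  rw [show 2 * N + 1 = N + 1 + N by ring, sum_range_add, sum_range_succ, hr] at hs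
  have hzero : cubicTrace ((N : ℤ) - N) - 2 * paritySign ((N : ℤ) - N) = 0 := by
    simp [cubicTrace, paritySign]
  rw [hzero] at hs
  linarith

/-- Modulo `p` the upper index is `-(2k+2)`, so this is the negation rule for binomial coefficients;
`i < p` keeps the denominators invertible. -/
theorem choose_two_mul_sub_eq_alternating {p : ℕ} [Fact p.Prime] {k i : ℕ} (hk : k < p)
    (hi : i < p) : ((2 * (p - (k + 1))).choose i : ZMod p) = (-1) ^ i * (2 * k + 1 + i).choose i := by
  induction i with
  | zero => simp
  | succ i ih =>
    have h1 : ((i + 1 : ℕ) : ZMod p) ≠ 0 := by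
      rw [Ne, ZMod.natCast_eq_zero_iff]
      exact fun h => absurd (Nat.le_of_dvd (by omega) h) (by omega)
    apply mul_right_cancel₀ h1
    have h2 : ((2 * (p - (k + 1))).choose (i + 1) : ZMod p) * (i + 1 : ℕ) =
        (2 * (p - (k + 1))).choose i * (2 * (p - (k + 1) : ℕ) - i) := by
      rcases le_or_gt i (2 * (p - (k + 1))) with h | h
      · have := Nat.choose_succ_right_eq (2 * (p - (k + 1))) i
        have h3 : ((2 * (p - (k + 1)) - i : ℕ) : ZMod p) = 2 * (p - (k + 1) : ℕ) - i := by
          rw [Nat.cast_sub h]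
          push_cast
          rfl
        rw [← h3]
        exact_mod_cast congrArg (Nat.cast : ℕ → ZMod p) this
      · simp [Nat.choose_eq_zero_of_lt h, Nat.choose_eq_zero_of_lt (h.trans i.lt_succ_self)]
    have h3 : ((p - (k + 1) : ℕ) : ZMod p) = -(k + 1) := by
      rw [Nat.cast_sub (by omega)]
      simp
    have h4 : ((2 * k + 1 + (i + 1)).choose (i + 1) : ZMod p) * (i + 1 : ℕ) =
        (2 * k + 1 + i).choose i * (2 * k + 1 + i + 1) := by
      have := Nat.add_one_mul_choose_eq (2 * k + 1 + i) i
      have := congrArg (Nat.cast : ℕ → ZMod p) this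
      push_cast at this ⊢
      rw [← add_assoc (2 * k + 1) i 1, ← this]
      ring
    rw [h2, ih (by omega), h3, mul_assoc, mul_assoc, h4, pow_succ]
    ring

open Finset in
theorem sum_eq_sum_mul_of_alternating_sum {p : ℕ} [Fact p.Prime] (D r : ℕ → ZMod p)
    (h : ∀ J < p - 1, ∑ k ∈ range (J + 1),
      (-1) ^ (J - k) * ((J + k + 1).choose (J - k) : ZMod p) * D k = r J) :
    ∑ k ∈ range (p - 1), D k = ∑ J ∈ range (p - 1),
      ((cubicTrace (p - (J + 1 : ℕ)) - 2 * paritySign (p - (J + 1 : ℕ)) : ℤ) : ZMod p) * r J := by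
  have h1 : ∀ k ∈ range (p - 1), D k = ∑ i ∈ range (p - 1 - k),
      ((cubicTrace (p - (k + i + 1 : ℕ)) - 2 * paritySign (p - (k + i + 1 : ℕ)) : ℤ) : ZMod p) *
        ((-1) ^ i * ((2 * k + 1 + i).choose i : ZMod p) * D k) := by
    intro k hk
    rw [mem_range] at hk
    -- Each `D k` is multiplied by an expansion of `1` with `N = p - (k+1)`, which is positive since
    -- `k < p - 1`.
    have e := sum_range_choose_mul_cubicTrace_sub (p - (k + 1)) (by omega)
    have e' := congrArg (Int.cast : ℤ → ZMod p) e
    rw [Int.cast_sum, Int.cast_one] at e'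
    refine ((one_mul (D k)).symm.trans (congrArg (· * D k) e'.symm)).trans ?_
    rw [sum_mul, show p - 1 - k = p - (k + 1) by omega]
    refine sum_congr rfl fun i hi => ?_
    rw [mem_range] at hi
    rw [Int.cast_mul, Int.cast_natCast,
      choose_two_mul_sub_eq_alternating (by omega : k < p) (by omega : i < p)]
    rw [show ((p - (k + 1) : ℕ) : ℤ) - i = p - (k + i + 1 : ℕ) by
      rw [Nat.cast_sub (by omega)]; push_cast; ring]
    ring
  rw [sum_congr rfl h1]
  have h2 : ∀ J ∈ range (p - 1),
      ((cubicTrace (p - (J + 1 : ℕ)) - 2 * paritySign (p - (J + 1 : ℕ)) : ℤ) : ZMod p) * r J =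
      ∑ k ∈ range (J + 1),
        ((cubicTrace (p - (J + 1 : ℕ)) - 2 * paritySign (p - (J + 1 : ℕ)) : ℤ) : ZMod p) *
        ((-1) ^ (J - k) * ((J + k + 1).choose (J - k) : ZMod p) * D k) := by
    intro J hJ
    rw [← h J (mem_range.1 hJ), mul_sum]
  rw [sum_congr rfl h2, sum_sigma', sum_sigma']
  -- Interchange of summation along `J = k + i`; the weight depends on `J` only, so the inner sum is
  -- the transform.
  refine sum_nbij' (fun x => ⟨x.1 + x.2, x.1⟩) (fun x => ⟨x.2, x.1 - x.2⟩) ?_ ?_ ?_ ?_ ?_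
  · rintro ⟨k, i⟩ hx
    simp only [mem_sigma, mem_range] at hx ⊢
    omega
  · rintro ⟨J, k⟩ hx
    simp only [mem_sigma, mem_range] at hx ⊢
    omega
  · rintro ⟨k, i⟩ _
    simp
  · rintro ⟨J, k⟩ hx
    simp only [mem_sigma, mem_range] at hx
    simp only [Sigma.mk.injEq, heq_eq_eq, and_true]
    omega
  · rintro ⟨k, i⟩ _
    simp only
    rw [show k + i - k = i by omega, show k + i + k + 1 = 2 * k + 1 + i by ring]

/-! ### Relations between weighted sums of `1 / j²` modulo `p`. -/

/-- The weighted sum `∑ f(j) / j²` over `0 < j < p`, as an element of `ZMod p`. -/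
def sumDivSq (p : ℕ) (f : ℤ → ℤ) : ZMod p := ∑ j ∈ Finset.Ico 1 p, (f j : ZMod p) * ((j : ZMod p) ^ 2)⁻¹

theorem sumDivSq_reflect (p : ℕ) (f : ℤ → ℤ) :
    sumDivSq p (fun x => f (p - x)) = sumDivSq p f := by
  unfold sumDivSq
  refine Finset.sum_nbij' (fun j => p - j) (fun j => p - j) ?_ ?_ ?_ ?_ ?_
  · intro j hj; simp only [Finset.mem_Ico] at *; omega
  · intro j hj; simp only [Finset.mem_Ico] at *; omega
  · intro j hj; simp only [Finset.mem_Ico] at *; omega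
  · intro j hj; simp only [Finset.mem_Ico] at *; omega
  · intro j hj
    rw [Finset.mem_Ico] at hj
    rw [Nat.cast_sub hj.2.le, Nat.cast_sub hj.2.le]
    simp

theorem sumDivSq_add (p : ℕ) (f g : ℤ → ℤ) :
    sumDivSq p (fun x => f x + g x) = sumDivSq p f + sumDivSq p g := by
  simp [sumDivSq, add_mul, Finset.sum_add_distrib]

theorem sumDivSq_const_mul (p : ℕ) (a : ℤ) (f : ℤ → ℤ) :
    sumDivSq p (fun x => a * f x) = a * sumDivSq p f := by
  simp [sumDivSq, Finset.mul_sum, mul_assoc]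

-- Adding the `paritySign` twist keeps twice the even `j = 2i`, where `1/j^2` is a quarter of
-- `1/i^2`. The symmetry of `f (2 * x)` under `x ↦ p - x` extends `i ≤ (p-1)/2` to the full range.
open Finset in
theorem sumDivSq_comp_two_mul {p : ℕ} [Fact p.Prime] (hp : Odd p) (f : ℤ → ℤ)
    (hf : ∀ x, f (2 * (p - x)) = f (2 * x)) :
    4 * (sumDivSq p f + sumDivSq p (fun x => paritySign x * f x)) =
      sumDivSq p (fun x => f (2 * x)) := by
  have h2 : (2 : ZMod p) ≠ 0 := by
    intro h
    have : p ∣ 2 := (ZMod.natCast_eq_zero_iff 2 p).1 (by exact_mod_cast h)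
    have := (Nat.prime_dvd_prime_iff_eq Fact.out Nat.prime_two).1 this
    subst this
    exact absurd hp (by decide)
  obtain ⟨n, hn⟩ := hp
  have heven : ∀ m : ℕ, ∑ j ∈ Ico 1 (2 * m + 1),
      ((f j + paritySign j * f j : ℤ) : ZMod p) * ((j : ZMod p) ^ 2)⁻¹ =
      ∑ i ∈ Ico 1 (m + 1), 2 * (f (2 * i) : ZMod p) * (((2 * i : ℕ) : ZMod p) ^ 2)⁻¹ := by
    intro m
    induction m with
    | zero => simp
    | succ m ih =>
      rw [show 2 * (m + 1) + 1 = 2 * m + 1 + 1 + 1 by ring, sum_Ico_succ_top (by omega),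
        sum_Ico_succ_top (by omega), ih, sum_Ico_succ_top (b := m + 1) (by omega),
        paritySign_natCast, paritySign_natCast, pow_succ _ (2 * m + 1), pow_succ _ (2 * m), pow_mul]
      simp [mul_add]
      left
      ring
  have hhalf : sumDivSq p (fun x => f (2 * x)) =
      2 * ∑ i ∈ Ico 1 (n + 1), (f (2 * i) : ZMod p) * ((i : ZMod p) ^ 2)⁻¹ := by
    unfold sumDivSq
    rw [← sum_Ico_consecutive _ (show 1 ≤ n + 1 by omega) (show n + 1 ≤ p by omega), two_mul]
    congr 1
    refine sum_nbij' (fun j => p - j) (fun j => p - j) ?_ ?_ ?_ ?_ ?_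
    · intro j hj; simp only [mem_Ico] at *; omega
    · intro j hj; simp only [mem_Ico] at *; omega
    · intro j hj; simp only [mem_Ico] at *; omega
    · intro j hj; simp only [mem_Ico] at *; omega
    · intro j hj
      rw [mem_Ico] at hj
      rw [Nat.cast_sub hj.2.le, Nat.cast_sub hj.2.le, hf]
      simp
  rw [hhalf, ← sumDivSq_add]
  unfold sumDivSq
  rw [show Ico 1 p = Ico 1 (2 * n + 1) by rw [hn], heven, mul_sum, mul_sum]
  refine sum_congr rfl fun i hi => ?_
  have hi0 : (i : ZMod p) ≠ 0 := by
    rw [Ne, ZMod.natCast_eq_zero_iff]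
    rw [mem_Ico] at hi
    exact fun h => absurd (Nat.le_of_dvd (by omega) h) (by omega)
  push_cast
  field_simp
  ring

theorem sumDivSq_paritySign_mul {p : ℕ} (hp : Odd p) (f : ℤ → ℤ) :
    sumDivSq p (fun x => paritySign x * f (p - x)) = -sumDivSq p (fun x => paritySign x * f x) := by
  rw [← sumDivSq_reflect p (fun x => paritySign x * f x), ← neg_one_mul, ← Int.cast_one,
    ← Int.cast_neg, ← sumDivSq_const_mul]
  congr 1
  ext x
  rw [sub_eq_add_neg, paritySign_add, paritySign_neg, paritySign_natCast, hp.neg_one_pow]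
  ring

theorem ZMod.natCast_ne_zero_of_lt {p n : ℕ} (h0 : 0 < n) (h : n < p) : (n : ZMod p) ≠ 0 := by
  rw [Ne, ZMod.natCast_eq_zero_iff]
  exact fun hd => absurd (Nat.le_of_dvd h0 hd) (by omega)

theorem sumDivSq_one {p : ℕ} [Fact p.Prime] (hp3 : 3 < p) : sumDivSq p (fun _ => 1) = 0 := by
  have hodd : Odd p := (Fact.out : p.Prime).odd_of_ne_two (by omega)
  have h := sumDivSq_comp_two_mul hodd (fun _ => 1) (fun _ => rfl)
  have h' := sumDivSq_paritySign_mul hodd (fun _ => 1)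
  simp only at h h'
  have h2 := ZMod.natCast_ne_zero_of_lt (p := p) (n := 2) (by omega) (by omega)
  have h3 := ZMod.natCast_ne_zero_of_lt (p := p) (n := 3) (by omega) (by omega)
  push_cast at h2 h3
  apply mul_left_cancel₀ h3
  linear_combination h - 2 * h'

theorem sumDivSq_paritySign {p : ℕ} [Fact p.Prime] (hp3 : 3 < p) : sumDivSq p paritySign = 0 := by
  have hodd : Odd p := (Fact.out : p.Prime).odd_of_ne_two (by omega)
  have h' := sumDivSq_paritySign_mul hodd (fun _ => 1)
  have h2 := ZMod.natCast_ne_zero_of_lt (p := p) (n := 2) (by omega) (by omega)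
  push_cast at h2
  simp only [mul_one] at h'
  apply mul_left_cancel₀ h2
  linear_combination h'

/-- Apply doubling to `cubicTrace (p - x)`. The resulting weight `cubicTrace (p - 2x)` equals
`cubicTrace (x + p)`, and the traces at `x`, `x + p`, `x - p` add to `0` because `3 ∤ p`. -/
theorem sumDivSq_paritySign_mul_cubicTrace {p : ℕ} [Fact p.Prime] (hp3 : 3 < p) :
    2 * sumDivSq p (fun x => paritySign x * cubicTrace x) = 3 * sumDivSq p cubicTrace := by
  have hp : p.Prime := Fact.out
  have hodd : Odd p := hp.odd_of_ne_two (by omega)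
  have h3p : ¬ (3 : ℤ) ∣ p := by
    intro h
    have := (Nat.prime_dvd_prime_iff_eq Nat.prime_three hp).1 (by exact_mod_cast h)
    omega
  have h1 := sumDivSq_comp_two_mul hodd (fun x => cubicTrace (p - x)) (fun x => by
    rw [← cubicTrace_neg]; congr 1; ring)
  rw [sumDivSq_paritySign_mul hodd, sumDivSq_reflect] at h1
  have h2 : sumDivSq p cubicTrace + sumDivSq p (fun x => cubicTrace (p - 2 * x)) +
      sumDivSq p (fun x => cubicTrace (p - x)) = 0 := by
    rw [← sumDivSq_add, ← sumDivSq_add]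
    simp only [sumDivSq]
    refine Finset.sum_eq_zero fun j _ => ?_
    have e := cubicTrace_add_add j p h3p
    have e1 : cubicTrace (p - 2 * j) = cubicTrace (j + p) :=
      cubicTrace_eq_of_dvd_sub (by omega)
    have e2 : cubicTrace (p - j) = cubicTrace (j - p) := by
      rw [← cubicTrace_neg, neg_sub]
    rw [e1, e2, e]
    simp
  rw [sumDivSq_reflect] at h2
  have n2 := ZMod.natCast_ne_zero_of_lt (p := p) (n := 2) (by omega) (by omega)
  push_cast at n2
  apply mul_left_cancel₀ n2
  linear_combination -h1 - h2

open Finset in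
theorem sumDivSq_cubicTrace {p : ℕ} [Fact p.Prime] (hp3 : 3 < p) :
    3 * sumDivSq p cubicTrace = ∑ i ∈ Ico 1 (p / 3 + 1), ((i : ZMod p) ^ 2)⁻¹ := by
  have n3 := ZMod.natCast_ne_zero_of_lt (p := p) (n := 3) (by omega) (by omega)
  push_cast at n3
  have h1 : sumDivSq p cubicTrace = 3 * ∑ j ∈ Ico 1 p with 3 ∣ j, ((j : ZMod p) ^ 2)⁻¹ := by
    have h := sumDivSq_one hp3
    -- The sum with constant weight `1` vanishes and `cubicTrace x + 1` is `3` when `3 ∣ x`,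
    -- otherwise `0`; so only multiples of `3` survive.
    rw [← add_zero (sumDivSq p cubicTrace), ← h, ← sumDivSq_add, sum_filter, mul_sum]
    refine sum_congr rfl fun j _ => ?_
    by_cases hj : 3 ∣ j
    · simp [cubicTrace, hj, show (3 : ℤ) ∣ j by exact_mod_cast hj]
    · simp [cubicTrace, hj, show ¬ (3 : ℤ) ∣ j by exact_mod_cast hj]
  have h3p : ¬ 3 ∣ p := fun h => by
    have := (Nat.prime_dvd_prime_iff_eq Nat.prime_three Fact.out).1 h
    omega
  have h2 : ∑ j ∈ Ico 1 p with 3 ∣ j, ((j : ZMod p) ^ 2)⁻¹ =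
      ∑ i ∈ Ico 1 (p / 3 + 1), (((3 * i : ℕ) : ZMod p) ^ 2)⁻¹ := by
    refine sum_nbij' (fun j => j / 3) (fun i => 3 * i) ?_ ?_ ?_ ?_ ?_
    · intro j hj; simp only [mem_Ico, mem_filter] at *; omega
    · intro j hj; simp only [mem_Ico, mem_filter] at *; omega
    · intro j hj; simp only [mem_Ico, mem_filter] at *; omega
    · intro j hj; simp only [mem_Ico] at *; omega
    · intro j hj
      simp only [mem_filter] at hj
      rw [Nat.mul_div_cancel' hj.2]
  rw [h1, h2, mul_sum, mul_sum]
  refine sum_congr rfl fun i hi => ?_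
  have hi0 : (i : ZMod p) ≠ 0 := by
    rw [mem_Ico] at hi
    exact ZMod.natCast_ne_zero_of_lt (by omega) (by omega)
  push_cast
  field_simp

/-! ### Reduction of `p`-integral rationals modulo `p`. -/

/-- The ring of rational numbers whose denominator is prime to `p`. -/
def integralRationals (p : ℕ) [Fact p.Prime] : Subring ℚ where
  carrier := {q | (q.den : ZMod p) ≠ 0}
  mul_mem' {a b} ha hb h := by
    rw [ZMod.natCast_eq_zero_iff] at h
    have := h.trans (Rat.mul_den_dvd a b)
    rw [← ZMod.natCast_eq_zero_iff, Nat.cast_mul] at this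
    exact mul_ne_zero ha hb this
  add_mem' {a b} ha hb h := by
    rw [ZMod.natCast_eq_zero_iff] at h
    have := h.trans (Rat.add_den_dvd a b)
    rw [← ZMod.natCast_eq_zero_iff, Nat.cast_mul] at this
    exact mul_ne_zero ha hb this
  one_mem' := by simp
  zero_mem' := by simp
  neg_mem' {a} ha := by simpa using ha

namespace integralRationals

variable {p : ℕ} [Fact p.Prime]

theorem mem_iff {q : ℚ} : q ∈ integralRationals p ↔ (q.den : ZMod p) ≠ 0 := Iff.rfl

theorem cast_add {a b : ℚ} (ha : a ∈ integralRationals p) (hb : b ∈ integralRationals p) :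
    ((a + b : ℚ) : ZMod p) = a + b := Rat.cast_add_of_ne_zero ha hb

theorem cast_sub {a b : ℚ} (ha : a ∈ integralRationals p) (hb : b ∈ integralRationals p) :
    ((a - b : ℚ) : ZMod p) = a - b := Rat.cast_sub_of_ne_zero ha hb

theorem cast_mul {a b : ℚ} (ha : a ∈ integralRationals p) (hb : b ∈ integralRationals p) :
    ((a * b : ℚ) : ZMod p) = a * b := Rat.cast_mul_of_ne_zero ha hb

theorem cast_pow {a : ℚ} (ha : a ∈ integralRationals p) (n : ℕ) :
    ((a ^ n : ℚ) : ZMod p) = a ^ n := by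
  induction n with
  | zero => simp
  | succ n ih => rw [pow_succ, pow_succ, cast_mul (pow_mem ha n) ha, ih]

theorem cast_sum {ι : Type*} (s : Finset ι) (f : ι → ℚ) (hf : ∀ i ∈ s, f i ∈ integralRationals p) :
    ((∑ i ∈ s, f i : ℚ) : ZMod p) = ∑ i ∈ s, (f i : ZMod p) := by
  classical
  induction s using Finset.induction_on with
  | empty => simp
  | insert a s ha ih =>
    rw [Finset.sum_insert ha, Finset.sum_insert ha, cast_add (hf a (Finset.mem_insert_self a s))
      (sum_mem fun i hi => hf i (Finset.mem_insert_of_mem hi)),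
      ih fun i hi => hf i (Finset.mem_insert_of_mem hi)]

theorem inv_natCast_mem {n : ℕ} (hn : (n : ZMod p) ≠ 0) : (n : ℚ)⁻¹ ∈ integralRationals p := by
  rcases Nat.eq_zero_or_pos n with rfl | h
  · simp at hn
  · rwa [mem_iff, Rat.inv_natCast_den_of_pos h]

theorem cast_inv_natCast {n : ℕ} (hn : (n : ZMod p) ≠ 0) :
    (((n : ℚ)⁻¹ : ℚ) : ZMod p) = (n : ZMod p)⁻¹ := by
  rw [Rat.cast_inv_of_ne_zero (by simpa using hn), Rat.cast_natCast]

open Polynomial in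
theorem eval_mem {f : ℚ[X]} (hf : ∀ i, f.coeff i ∈ integralRationals p) {x : ℚ}
    (hx : x ∈ integralRationals p) : f.eval x ∈ integralRationals p := by
  rw [eval_eq_sum_range]
  exact sum_mem fun i _ => mul_mem (hf i) (pow_mem hx i)

open Polynomial in
theorem cast_eval_congr {f : ℚ[X]} (hf : ∀ i, f.coeff i ∈ integralRationals p) {x y : ℚ}
    (hx : x ∈ integralRationals p) (hy : y ∈ integralRationals p)
    (hxy : (x : ZMod p) = y) : ((f.eval x : ℚ) : ZMod p) = ((f.eval y : ℚ) : ZMod p) := by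
  rw [eval_eq_sum_range, eval_eq_sum_range,
    cast_sum _ _ fun i _ => mul_mem (hf i) (pow_mem hx i),
    cast_sum _ _ fun i _ => mul_mem (hf i) (pow_mem hy i)]
  refine Finset.sum_congr rfl fun i _ => ?_
  rw [cast_mul (hf i) (pow_mem hx i), cast_mul (hf i) (pow_mem hy i), cast_pow hx, cast_pow hy, hxy]

/-- The recursion divides only by integers up to `n + 1`, all prime to `p`. -/
theorem bernoulli'_mem (n : ℕ) (hn : n + 1 < p) : bernoulli' n ∈ integralRationals p := by
  induction n using Nat.strong_induction_on with
  | _ n ih =>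
    rw [bernoulli'_def]
    refine sub_mem (one_mem _) (sum_mem fun k hk => ?_)
    rw [Finset.mem_range] at hk
    refine mul_mem ?_ (ih k hk (by omega))
    rw [div_eq_mul_inv, show ((n : ℚ) - k + 1) = ((n - k + 1 : ℕ) : ℚ) by
      rw [Nat.cast_add, Nat.cast_sub hk.le, Nat.cast_one]]
    exact mul_mem (natCast_mem _ _)
      (inv_natCast_mem (ZMod.natCast_ne_zero_of_lt (by omega) (by omega)))

theorem coeff_bernoulli_mem {n : ℕ} (hn : n + 1 < p) (i : ℕ) :
    (Polynomial.bernoulli n).coeff i ∈ integralRationals p := by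
  rw [Polynomial.coeff_bernoulli]
  split_ifs
  · refine mul_mem ?_ (natCast_mem _ _)
    rw [bernoulli]
    exact mul_mem (pow_mem (neg_mem (one_mem _)) _) (bernoulli'_mem _ (by omega))
  · exact zero_mem _

theorem ratModEq {a b : ℚ} (ha : a ∈ integralRationals p) (hb : b ∈ integralRationals p)
    (h : (a : ZMod p) = b) : RatModEq p a b := by
  have hp : p.Prime := Fact.out
  have hcop : ∀ q ∈ integralRationals p, q.den.Coprime p := fun q hq =>
    ((hp.coprime_iff_not_dvd).2 fun hd => hq ((ZMod.natCast_eq_zero_iff _ _).2 hd)).symm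
  refine ⟨hcop a ha, hcop b hb, ?_⟩
  have h0 : ((a - b : ℚ) : ZMod p) = 0 := by rw [cast_sub ha hb, h, sub_self]
  rw [Rat.cast_def, div_eq_zero_iff] at h0
  exact (ZMod.intCast_zmod_eq_zero_iff_dvd _ _).1 (h0.resolve_right (sub_mem ha hb))

/-- Below `2p` the only non-integral term of `H_n` is `1/p`, and the binomial coefficient absorbs
it. This is needed for `H_{2k}` when `2k ≥ p`. -/
theorem choose_mul_harmonic_mem {n k : ℕ} (hn : n < 2 * p) (hk : p ≤ n → p ∣ n.choose k) :
    (n.choose k : ℚ) * harmonic n ∈ integralRationals p := by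
  rw [harmonic, Finset.mul_sum]
  refine sum_mem fun i hi => ?_
  rw [Finset.mem_range] at hi
  rcases eq_or_ne (i + 1) p with rfl | hne
  · obtain ⟨c, hc⟩ := hk (by omega)
    have h0 : ((i + 1 : ℕ) : ℚ) ≠ 0 := by positivity
    rw [hc, Nat.cast_mul, mul_comm ((i + 1 : ℕ) : ℚ), mul_assoc, mul_inv_cancel₀ h0, mul_one]
    exact natCast_mem _ _
  · refine mul_mem (natCast_mem _ _) (inv_natCast_mem ?_)
    rw [Ne, ZMod.natCast_eq_zero_iff]
    rintro ⟨c, hc⟩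
    rcases c with _ | _ | c
    · omega
    · omega
    · nlinarith

theorem harmonic_mem {n : ℕ} (hn : n < p) : harmonic n ∈ integralRationals p := by
  have := choose_mul_harmonic_mem (p := p) (n := n) (k := 0) (by omega) (by omega)
  simpa using this

theorem centralBinom_div_mul_harmonic_mem {k : ℕ} (hk : k + 1 < p) :
    ((2 * (k + 1)).choose (k + 1) : ℚ) / (k + 1 : ℕ) * harmonic (k + 1) ∈ integralRationals p := by
  rw [div_eq_mul_inv]
  exact mul_mem (mul_mem (natCast_mem _ _)
    (inv_natCast_mem (ZMod.natCast_ne_zero_of_lt (by omega) hk))) (harmonic_mem hk)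

theorem centralBinom_div_mul_harmonic_two_mul_mem {k : ℕ} (hk : k + 1 < p) :
    ((2 * (k + 1)).choose (k + 1) : ℚ) / (k + 1 : ℕ) * harmonic (2 * (k + 1)) ∈
      integralRationals p := by
  rw [div_eq_mul_inv, mul_right_comm]
  refine mul_mem (choose_mul_harmonic_mem (by omega) fun h => ?_)
    (inv_natCast_mem (ZMod.natCast_ne_zero_of_lt (by omega) hk))
  rw [two_mul] at h ⊢
  exact (Fact.out : p.Prime).dvd_choose_add hk hk h

/-! ### The two harmonic sums in terms of `sumDivSq p cubicTrace`. -/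

open Finset in
theorem sum_cast_eq_of_alternating_sum (t r : ℕ → ℚ) (ht : ∀ k, k + 1 < p → t k ∈ integralRationals p)
    (h : ∀ J, ∑ k ∈ range (J + 1), (-1 : ℚ) ^ (J - k) * (J + k + 1).choose (J - k) * t k = r J) :
    ∑ k ∈ range (p - 1), (t k : ZMod p) = ∑ J ∈ range (p - 1),
      ((cubicTrace (p - (J + 1 : ℕ)) - 2 * paritySign (p - (J + 1 : ℕ)) : ℤ) : ZMod p) * r J := by
  refine sum_eq_sum_mul_of_alternating_sum _ _ fun J hJ => ?_
  have hcoef : ∀ i n : ℕ, (-1 : ℚ) ^ i * n ∈ integralRationals p := fun i n =>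
    mul_mem (pow_mem (neg_mem (one_mem _)) _) (natCast_mem _ _)
  rw [← h J, cast_sum]
  · refine sum_congr rfl fun k hk => ?_
    rw [mem_range] at hk
    rw [cast_mul (hcoef _ _) (ht k (by omega)), cast_mul (pow_mem (neg_mem (one_mem _)) _)
      (natCast_mem _ _), cast_pow (neg_mem (one_mem _))]
    simp
  · intro k hk
    rw [mem_range] at hk
    exact mul_mem (hcoef _ _) (ht k (by omega))

theorem cast_intCast_div_sq {n : ℕ} (hn : (n : ZMod p) ≠ 0) (a : ℤ) :
    (((a : ℚ) / (n : ℚ) ^ 2 : ℚ) : ZMod p) = a * ((n : ZMod p) ^ 2)⁻¹ := by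
  rw [div_eq_mul_inv, ← inv_pow, cast_mul (intCast_mem _ _) (pow_mem (inv_natCast_mem hn) 2),
    cast_pow (inv_natCast_mem hn), cast_inv_natCast hn, Rat.cast_intCast, inv_pow]

open Finset in
theorem sum_cast_eq_sumDivSq (t : ℕ → ℚ) (ht : ∀ k, k + 1 < p → t k ∈ integralRationals p)
    (r : ℤ → ℤ) (h : ∀ J, ∑ k ∈ range (J + 1),
      (-1 : ℚ) ^ (J - k) * (J + k + 1).choose (J - k) * t k = r (J + 1 : ℕ) / ((J + 1 : ℕ) : ℚ) ^ 2) :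
    ∑ k ∈ range (p - 1), (t k : ZMod p) =
      sumDivSq p (fun x => (cubicTrace (p - x) - 2 * paritySign (p - x)) * r x) := by
  rw [sum_cast_eq_of_alternating_sum t _ ht h, sumDivSq, sum_Ico_eq_sum_range]
  refine sum_congr rfl fun J hJ => ?_
  rw [mem_range] at hJ
  rw [cast_intCast_div_sq (ZMod.natCast_ne_zero_of_lt (by omega) (by omega)), add_comm 1 J,
    Int.cast_mul, mul_assoc]

open Finset in
theorem sum_centralBinom_harmonic (hp3 : 3 < p) :
    ∑ k ∈ range (p - 1), ((((2 * (k + 1)).choose (k + 1) : ℚ) / (k + 1 : ℕ) *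
      harmonic (k + 1) : ℚ) : ZMod p) = 2 * sumDivSq p cubicTrace := by
  rw [sum_cast_eq_sumDivSq _ (fun k hk => centralBinom_div_mul_harmonic_mem hk) (fun _ => 2)
    (fun J => by rw [sum_range_alternating_centralBinom_mul_harmonic]; push_cast; rfl)]
  have h := sumDivSq_add p (fun x => 2 * cubicTrace (p - x)) (fun x => -4 * paritySign (p - x))
  rw [sumDivSq_const_mul, sumDivSq_const_mul, sumDivSq_reflect, sumDivSq_reflect,
    sumDivSq_paritySign hp3, mul_zero, add_zero] at h
  refine Eq.trans ?_ (h.trans (by push_cast; rfl))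
  congr 1
  ext x
  ring

open Finset in
theorem sum_centralBinom_harmonic_sub (hp3 : 3 < p) :
    2 * ∑ k ∈ range (p - 1), ((((2 * (k + 1)).choose (k + 1) : ℚ) / (k + 1 : ℕ) *
      (harmonic (2 * (k + 1)) - harmonic (k + 1)) : ℚ) : ZMod p) = 3 * sumDivSq p cubicTrace := by
  have hodd : Odd p := (Fact.out : p.Prime).odd_of_ne_two (by omega)
  rw [sum_cast_eq_sumDivSq _ (fun k hk => by
      rw [mul_sub]
      exact sub_mem (centralBinom_div_mul_harmonic_two_mul_mem hk)
        (centralBinom_div_mul_harmonic_mem hk)) (fun x => -paritySign x)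
    (fun J => by
      rw [sum_range_alternating_centralBinom_mul_harmonic_sub, paritySign_natCast]
      push_cast
      ring),
    ← sumDivSq_paritySign_mul_cubicTrace hp3]
  have h := sumDivSq_add p (fun x => paritySign x * cubicTrace x) (fun x => -2 * 1)
  rw [sumDivSq_const_mul p (-2), sumDivSq_one hp3, mul_zero, add_zero] at h
  rw [← h, ← sumDivSq_reflect p (fun x => paritySign x * cubicTrace x + -2 * 1)]
  congr 2
  ext x
  -- As `p` is odd, the sign `-paritySign x` from the transform becomes `paritySign (p - x)`, whose
  -- square turns the parity part of the weight into the constant `-2`.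
  have hps : paritySign (p - x) = -paritySign x := by
    rw [sub_eq_add_neg, paritySign_add, paritySign_neg, paritySign_natCast, hodd.neg_one_pow]
    ring
  rw [hps]
  linear_combination -2 * paritySign_mul_self x

/-! ### The Bernoulli polynomial value at `1/3`. -/

theorem legendreSym_three (n : ℕ) :
    (n % 3 = 1 → legendreSym 3 n = 1) ∧ (n % 3 = 2 → legendreSym 3 n = -1) := by
  have h1 : legendreSym 3 1 = 1 := by decide
  have h2 : legendreSym 3 2 = -1 := by decide
  constructor <;> intro h <;> rw [legendreSym.mod]
  · rwa [show (n : ℤ) % (3 : ℕ) = 1 by omega]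
  · rwa [show (n : ℤ) % (3 : ℕ) = 2 by omega]

theorem one_third_mem (hp3 : 3 < p) : (1 / 3 : ℚ) ∈ integralRationals p := by
  have := inv_natCast_mem (ZMod.natCast_ne_zero_of_lt (p := p) (n := 3) (by omega) hp3)
  simpa using this

-- Faulhaber's formula evaluates the power sum at `p / 3 + 1`, which is congruent to `2/3` or `1/3`
-- according to `p % 3`. The reflection `x ↦ 1 - x` in odd degree changes the sign, which is the
-- origin of the Legendre symbol.
open Finset in
theorem cast_bernoulli_eval_one_third (hp3 : 3 < p) :
    (legendreSym 3 p : ZMod p) *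
      (((Polynomial.bernoulli (p - 2)).eval (1 / 3 : ℚ) : ℚ) : ZMod p) =
      2 * ∑ i ∈ Ico 1 (p / 3 + 1), ((i : ZMod p) ^ 2)⁻¹ := by
  have hp : p.Prime := Fact.out
  have hodd : Odd p := hp.odd_of_ne_two (by omega)
  have hodd2 : Odd (p - 2) := Nat.Odd.sub_even (by omega) hodd (by decide)
  have h5 : p - 2 = (p - 3).succ := by omega
  have n3 := ZMod.natCast_ne_zero_of_lt (p := p) (n := 3) (by omega) (by omega)
  have hcoeff := coeff_bernoulli_mem (p := p) (n := p - 2) (by omega)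
  have hthird := one_third_mem hp3
  have hthird_cast : ((1 / 3 : ℚ) : ZMod p) = 3⁻¹ := by
    have := cast_inv_natCast n3
    simpa using this
  push_cast at n3
  have hb : bernoulli (p - 2) = 0 := by
    have hne : p ≠ 4 := by rintro rfl; exact absurd hp (by decide)
    rw [bernoulli, bernoulli'_eq_zero_of_odd hodd2 (by omega), mul_zero]
  have hsum := Polynomial.sum_range_pow_eq_bernoulli_sub (p / 3 + 1) (p - 3)
  rw [← h5, hb, sub_zero] at hsum
  -- The factor `-2` is the exponent `p - 2` modulo `p`, and `i^(p-3) = i^(-2)` by Fermat.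
  have hcast : (((Polynomial.bernoulli (p - 2)).eval ((p / 3 + 1 : ℕ) : ℚ) : ℚ) : ZMod p) =
      -2 * ∑ i ∈ Ico 1 (p / 3 + 1), ((i : ZMod p) ^ 2)⁻¹ := by
    rw [← hsum, show ((p - 3 : ℕ) + 1 : ℚ) * ∑ k ∈ range (p / 3 + 1), (k : ℚ) ^ (p - 3) =
      (((p - 3 + 1) * ∑ k ∈ range (p / 3 + 1), k ^ (p - 3) : ℕ) : ℚ) by push_cast; rfl,
      Rat.cast_natCast, Nat.cast_mul, show p - 3 + 1 = p - 2 by omega, Nat.cast_sub (by omega),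
      range_eq_Ico, sum_eq_sum_Ico_succ_bot (by omega), zero_pow (by
        have hne : p ≠ 3 := by omega
        omega)]
    simp only [CharP.cast_eq_zero, Nat.cast_ofNat, zero_sub, zero_add, Nat.cast_sum]
    congr 1
    refine sum_congr rfl fun i hi => ?_
    rw [mem_Ico] at hi
    have hi0 := ZMod.natCast_ne_zero_of_lt (p := p) (n := i) (by omega) (by omega)
    rw [Nat.cast_pow]
    apply eq_inv_of_mul_eq_one_left
    rw [← pow_add, show p - 3 + 2 = p - 1 by omega, ZMod.pow_card_sub_one_eq_one hi0]
  have hmod : p % 3 = 1 ∨ p % 3 = 2 := by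
    have : ¬ 3 ∣ p := fun h => by
      have := (Nat.prime_dvd_prime_iff_eq Nat.prime_three hp).1 h
      omega
    omega
  rcases hmod with hm | hm
  · have hrefl := Polynomial.bernoulli_eval_one_sub (p - 2) (1 / 3)
    rw [hodd2.neg_one_pow] at hrefl
    have h2 : ((p / 3 + 1 : ℕ) : ZMod p) = ((1 - 1 / 3 : ℚ) : ZMod p) := by
      rw [cast_sub (one_mem _) hthird, hthird_cast, Rat.cast_one]
      apply mul_left_cancel₀ n3
      have : 3 * (p / 3 + 1) = p + 2 := by omega
      have := congrArg (Nat.cast : ℕ → ZMod p) this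
      simp only [Nat.cast_mul, Nat.cast_add, CharP.cast_eq_zero, Nat.cast_ofNat] at this
      rw [mul_sub, mul_inv_cancel₀ n3, Nat.cast_add, this]
      norm_num
    rw [cast_eval_congr hcoeff (natCast_mem _ _) (sub_mem (one_mem _) hthird)
      ((Rat.cast_natCast _).trans h2), hrefl, neg_one_mul, Rat.cast_neg] at hcast
    rw [(legendreSym_three p).1 hm, Int.cast_one]
    linear_combination -hcast
  · have h2 : ((p / 3 + 1 : ℕ) : ZMod p) = ((1 / 3 : ℚ) : ZMod p) := by
      rw [hthird_cast]
      apply mul_left_cancel₀ n3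
      have : 3 * (p / 3 + 1) = p + 1 := by omega
      have := congrArg (Nat.cast : ℕ → ZMod p) this
      simp only [Nat.cast_mul, Nat.cast_add, CharP.cast_eq_zero, Nat.cast_ofNat] at this
      rw [mul_inv_cancel₀ n3, Nat.cast_add, this]
      norm_num
    rw [cast_eval_congr hcoeff (natCast_mem _ _) hthird
      ((Rat.cast_natCast _).trans h2)] at hcast
    rw [(legendreSym_three p).2 hm, Int.cast_neg, Int.cast_one]
    linear_combination -hcast

theorem cast_div_twelve_mul (hp3 : 3 < p) (a : ℕ) {x : ℚ} (hx : x ∈ integralRationals p) :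
    (a / 12 * (legendreSym 3 p : ℚ) * x ∈ integralRationals p) ∧
      12 * ((a / 12 * (legendreSym 3 p : ℚ) * x : ℚ) : ZMod p) = a * (legendreSym 3 p * x) := by
  have n2 := ZMod.natCast_ne_zero_of_lt (p := p) (n := 2) (by omega) (by omega)
  have n3 := ZMod.natCast_ne_zero_of_lt (p := p) (n := 3) (by omega) (by omega)
  have n12 : ((12 : ℕ) : ZMod p) ≠ 0 := by
    rw [show 12 = 2 * 2 * 3 by norm_num, Nat.cast_mul, Nat.cast_mul]
    exact mul_ne_zero (mul_ne_zero n2 n2) n3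
  have hmem := inv_natCast_mem n12
  have hcast := cast_inv_natCast n12
  push_cast at n12 hmem hcast
  have ha : (a / 12 : ℚ) ∈ integralRationals p := by
    rw [div_eq_mul_inv]
    exact mul_mem (natCast_mem _ _) hmem
  have hal := mul_mem ha (intCast_mem (integralRationals p) (legendreSym 3 p))
  refine ⟨mul_mem hal hx, ?_⟩
  rw [cast_mul hal hx, cast_mul ha (intCast_mem _ _), div_eq_mul_inv, cast_mul (natCast_mem _ _) hmem,
    hcast, Rat.cast_intCast, Rat.cast_natCast]
  field_simp

end integralRationals

/-! ### Comparison of the constants, with denominators cleared by `12`. -/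

open integralRationals in
theorem theorem1p1 (p : ℕ) (hp : p.Prime) (hp3 : 3 < p) :
    RatModEq p
      (∑ k ∈ Finset.Icc 1 (p - 1), ((2 * k).choose k : ℚ) / (k : ℚ) * harmonic k)
      (1 / 3 * (legendreSym 3 (p : ℤ) : ℚ) * (Polynomial.bernoulli (p - 2)).eval (1 / 3 : ℚ)) ∧
    RatModEq p
      (∑ k ∈ Finset.Icc 1 (p - 1), ((2 * k).choose k : ℚ) / (k : ℚ) * harmonic (2 * k))
      (7 / 12 * (legendreSym 3 (p : ℤ) : ℚ) *
        (Polynomial.bernoulli (p - 2)).eval (1 / 3 : ℚ)) := by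
  have : Fact p.Prime := ⟨hp⟩
  have hshift : ∀ f : ℕ → ℚ, ∑ k ∈ Finset.Icc 1 (p - 1), f k =
      ∑ k ∈ Finset.range (p - 1), f (k + 1) := by
    intro f
    rw [show Finset.Icc 1 (p - 1) = Finset.Ico 1 p by
      ext; simp only [Finset.mem_Icc, Finset.mem_Ico]; omega, Finset.sum_Ico_eq_sum_range]
    simp only [add_comm 1]
  have n2 := ZMod.natCast_ne_zero_of_lt (p := p) (n := 2) (by omega) (by omega)
  have n3 := ZMod.natCast_ne_zero_of_lt (p := p) (n := 3) (by omega) (by omega)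
  push_cast at n2 n3
  have n12 : (12 : ZMod p) ≠ 0 := by
    rw [show (12 : ZMod p) = 2 * 2 * 3 by norm_num]
    exact mul_ne_zero (mul_ne_zero n2 n2) n3
  have hx := eval_mem (coeff_bernoulli_mem (p := p) (n := p - 2) (by omega)) (one_third_mem hp3)
  have hB := cast_bernoulli_eval_one_third hp3
  rw [← sumDivSq_cubicTrace hp3] at hB
  obtain ⟨hm4, hc4⟩ := cast_div_twelve_mul hp3 4 hx
  obtain ⟨hm7, hc7⟩ := cast_div_twelve_mul hp3 7 hx
  have h1mem : ∀ k ∈ Finset.range (p - 1), _ := fun k hk =>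
    centralBinom_div_mul_harmonic_mem (p := p) (k := k) (by rw [Finset.mem_range] at hk; omega)
  have h2mem : ∀ k ∈ Finset.range (p - 1), _ := fun k hk =>
    centralBinom_div_mul_harmonic_two_mul_mem (p := p) (k := k)
      (by rw [Finset.mem_range] at hk; omega)
  have h1 := sum_centralBinom_harmonic hp3
  have h2 := sum_centralBinom_harmonic_sub hp3
  rw [Finset.sum_congr rfl fun k hk => by
    rw [mul_sub, integralRationals.cast_sub (h2mem k hk) (h1mem k hk)],
    Finset.sum_sub_distrib, h1, ← integralRationals.cast_sum _ _ h2mem] at h2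
  rw [← integralRationals.cast_sum _ _ h1mem] at h1
  rw [hshift, hshift]
  constructor
  · rw [show (1 / 3 : ℚ) * (legendreSym 3 (p : ℤ) : ℚ) =
      (4 : ℕ) / 12 * (legendreSym 3 (p : ℤ) : ℚ) by norm_num]
    refine ratModEq (sum_mem h1mem) hm4 ?_
    apply mul_left_cancel₀ n12
    rw [hc4, hB, h1]
    push_cast
    ring
  · refine ratModEq (sum_mem h2mem) (by exact_mod_cast hm7) ?_
    apply mul_left_cancel₀ n12
    rw [show (7 / 12 : ℚ) = (7 : ℕ) / 12 by norm_num, hc7, hB, Nat.cast_ofNat]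
    -- With `T = sumDivSq p cubicTrace` and `S` the `H_{2k}` sum, `h2` reads `2 * (S - 2T) = 3T`,
    -- hence `12 S = 42 T = 7 * 6T`.
    linear_combination 6 * h2
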